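/- Let $V=\{1,\dots,n\}$, let $G,H$ be simple undirected graphs on $V$ with edge sets $E_G,E_H$, and let $k>1$. Let $Q_{G,H}$ be the set of all $X\in[0,1]^{n\times n}$ with $Xe=X^{T}e=e$ ($e$ the all-ones vector) such that $X_{u_1v_1}X_{u_2v_2}=0$ whenever $\{u_1,u_2\}\in E_G$, $\{v_1,v_2\}\notin E_H$, and whenever $\{u_1,u_2\}\notin E_G$, $\{v_1,v_2\}\in E_H$. For a set $P=\{x\in[0,1]^N: f_j(x)=0\ (1\le j\le s),\ g_j(x)\ge 0\ (1\le j\le t)\}$ with real polynomials $f_j,g_j$, the $r$-th Sherali–Adams relaxation $P^r$ is obtained as follows: take the constraints $\prod_{i\in I}x_i\,f_j(x)=0$ for $|I|\le r-1$; $\prod_{i\in I}x_i\prod_{i\in J\setminus I}(1-x_i)\,g_j(x)\ge 0$ for $I\subseteq J$, $|J|\le r-1$; and $\prod_{i\in I}x_i\prod_{i\in J\setminus I}(1-x_i)\ge 0$ for $I\subseteq J$, $|J|\le r$; expand them, make every monomial square-free by replacing $x_i^2$ by $x_i$, and replace every monomial $\prod_{i\in I}x_i$ by a new variable $y_I$,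 with $y_\emptyset=1$; then project the solution set to the coordinates $x_i=y_{\{i\}}$. Let $Q^{r}_{G,H}$ be the $r$-th Sherali–Adams relaxation of $Q_{G,H}$, and $Q^r_G=Q^r_{G,G}$. The $k$-dimensional Weisfeiler–Lehman algorithm for automorphism starts with the partition of $V^k$ in which $u\equiv v$ if and only if, for all $i,j$, $u_i=u_j\Leftrightarrow v_i=v_j$ and $\{u_i,u_j\}\in E_G\Leftrightarrow\{v_i,v_j\}\in E_G$. It refines the partition repeatedly until it no longer changes: in one step, $u\equiv v$ stay equivalent if and only if there is a bijection $\psi:V\to V$ with $(u_1,\dots,u_{i-1},w,u_{i+1},\dots,u_k)\equiv(v_1,\dots,v_{i-1},\psi(w),v_{i+1},\dots,v_k)$ for all $1\le i\le k$ and $w\in V$. It determines that $G$ is asymmetric if all cells of the final partition are singletons. For isomorphism, the algorithm runs on $G$ and on $H$ separately, with ordered partitions: the initial cells are sorted lexicographically by the matrix of the tuple $u$ with entries $0$ if $u_i=u_j$, $1$ if $\{u_i,u_j\}\in E_G$, and $-1$ otherwise; a refinement step sorts the tuples lexicographically by the index of the cell of $u$ followed by the sorted list, over $w\in V$, of the vectors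 of cell indices of $(u_1,\dots,u_{i-1},w,u_{i+1},\dots,u_k)$, $1\le i\le k$. It determines that $G$ and $H$ are not isomorphic unless both the initial and the final ordered partitions of $G$ and $H$ match, that is, unless in both cases the cells have the same sizes and tuples in cells with the same index have the same sorting data (for the initial partitions the matrix, for the final ones the data of the refinement step). Then: 1. $Q^{k+1}_{G}=\{I_n\}$ if and only if the $k$-dimensional Weisfeiler–Lehman algorithm determines that $G$ is asymmetric. 2. $Q^{k+1}_{G,H}=\emptyset$ if and only if the $k$-dimensional Weisfeiler–Lehman algorithm determines that $G$ and $H$ are not isomorphic. -/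

import Mathlib

/-! ### The Sherali-Adams hierarchy -/

namespace SheraliAdams

open MvPolynomial

variable {σ : Type*} [DecidableEq σ]

/-- Expand `p` into monomials, make every monomial square-free (only the set of variables that
occur in it is kept), and replace the square-free monomial on the variable set `I` by the
number `y I`. -/
noncomputable def linearize (y : Finset σ → ℝ) (p : MvPolynomial σ ℝ) : ℝ :=
  ∑ m ∈ p.support, p.coeff m * y m.support

/-- The polynomial `∏_{i ∈ I} x_i ∏_{i ∈ J \ I} (1 - x_i)`. -/
noncomputable def boxFactor (I J : Finset σ) : MvPolynomial σ ℝ :=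
  (∏ i ∈ I, X i) * ∏ i ∈ J \ I, (1 - X i)

/-- The points `y` of the `k`-th extended formulation of the semi-algebraic set
`{x ∈ [0,1]^σ | f x = 0 for f ∈ eqs, g x ≥ 0 for g ∈ ineqs}`. The value `y ∅` stands for the
constant monomial, so it is `1`. Values `y I` that occur in none of the constraints are free. -/
structure IsExtendedPoint (k : ℕ) (eqs ineqs : Set (MvPolynomial σ ℝ)) (y : Finset σ → ℝ) :
    Prop where
  empty_eq_one : y ∅ = 1
  eq_zero : ∀ f ∈ eqs, ∀ I : Finset σ, I.card + 1 ≤ k →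
    linearize y ((∏ i ∈ I, X i) * f) = 0
  ineq_nonneg : ∀ g ∈ ineqs, ∀ I J : Finset σ, I ⊆ J → J.card + 1 ≤ k →
    0 ≤ linearize y (boxFactor I J * g)
  box_nonneg : ∀ I J : Finset σ, I ⊆ J → J.card ≤ k →
    0 ≤ linearize y (boxFactor I J)

/-- The `k`-th Sherali-Adams relaxation of
`{x ∈ [0,1]^σ | f x = 0 for f ∈ eqs, g x ≥ 0 for g ∈ ineqs}`: the projection of the `k`-th
extended formulation to the coordinates `x i = y {i}`. -/
def relaxation (k : ℕ) (eqs ineqs : Set (MvPolynomial σ ℝ)) : Set (σ → ℝ) :=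
  {x | ∃ y : Finset σ → ℝ, IsExtendedPoint k eqs ineqs y ∧ ∀ i, x i = y {i}}

end SheraliAdams

/-! ### The semi-algebraic set of graph isomorphisms and its relaxations -/

namespace GraphIso

open MvPolynomial

variable {n : ℕ}

/-- The equations of `Q_{G,H}` in the entries of an `n × n` matrix `X`: `X e = e`, `Xᵀ e = e`,
and `X_{u₁v₁} X_{u₂v₂} = 0` whenever exactly one of `{u₁,u₂} ∈ E_G` and `{v₁,v₂} ∈ E_H` holds.
The remaining constraint `X ∈ [0,1]^{n × n}` is part of the Sherali-Adams construction. -/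
def equations (G H : SimpleGraph (Fin n)) : Set (MvPolynomial (Fin n × Fin n) ℝ) :=
  {p | ∃ u, p = (∑ w, X (u, w)) - 1} ∪
  {p | ∃ v, p = (∑ w, X (w, v)) - 1} ∪
  {p | ∃ u₁ u₂ v₁ v₂, G.Adj u₁ u₂ ∧ ¬ H.Adj v₁ v₂ ∧ p = X (u₁, v₁) * X (u₂, v₂)} ∪
  {p | ∃ u₁ u₂ v₁ v₂, ¬ G.Adj u₁ u₂ ∧ H.Adj v₁ v₂ ∧ p = X (u₁, v₁) * X (u₂, v₂)}

/-- `Q^k_{G,H}`, the `k`-th Sherali-Adams relaxation of `Q_{G,H}`, as a set of matrices. -/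
def relaxationQ (k : ℕ) (G H : SimpleGraph (Fin n)) : Set (Matrix (Fin n) (Fin n) ℝ) :=
  {M | (fun e : Fin n × Fin n => M e.1 e.2) ∈ SheraliAdams.relaxation k (equations G H) ∅}

end GraphIso

/-! ### The Weisfeiler-Lehman algorithm -/

namespace WeisfeilerLehman

variable {n k : ℕ}

/-- `k`-tuples of vertices. Replacing the `i`-th entry of `u` by `w` is
`Function.update u i w`. -/
abbrev Tuple (n k : ℕ) : Type := Fin k → Fin n

/-- The fixed point that is reached by applying `f` recursively to `x`: the first iterate that
`f` does not change. -/
noncomputable def iterateToFixed {β : Type*} (f : β → β) (x : β) : β :=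
  f^[sInf {r | Function.IsFixedPt f (f^[r] x)}] x

/-! #### Automorphism algorithm: partitions of the set of `k`-tuples -/

/-- The partition of the `k`-tuples into types of ordered induced subgraphs. -/
def initial (G : SimpleGraph (Fin n)) (k : ℕ) : Setoid (Tuple n k) where
  r u v := (∀ i j, u i = u j ↔ v i = v j) ∧ ∀ i j, G.Adj (u i) (u j) ↔ G.Adj (v i) (v j)
  iseqv :=
    { refl := fun _ => ⟨fun _ _ => Iff.rfl, fun _ _ => Iff.rfl⟩
      symm := fun h => ⟨fun i j => (h.1 i j).symm, fun i j => (h.2 i j).symm⟩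
      trans := fun h h' =>
        ⟨fun i j => (h.1 i j).trans (h'.1 i j), fun i j => (h.2 i j).trans (h'.2 i j)⟩ }

/-- One refinement step: `u` and `v` stay equivalent if they were and there is a bijection `ψ`
of the vertices such that, for every vertex `w` and every position `i`, replacing the `i`-th
entry by `w` in `u` and by `ψ w` in `v` gives equivalent tuples. -/
def refine (π : Setoid (Tuple n k)) : Setoid (Tuple n k) where
  r u v := π u v ∧ ∃ ψ : Equiv.Perm (Fin n), ∀ (i : Fin k) (w : Fin n),
    π (Function.update u i w) (Function.update v i (ψ w))
  iseqv :=
    { refl := fun u => ⟨π.refl u, Equiv.refl _, fun _ _ => π.refl _⟩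
      symm := fun {u v} h => ⟨π.symm h.1, h.2.choose.symm, fun i w => by
        have := h.2.choose_spec i (h.2.choose.symm w)
        rw [Equiv.apply_symm_apply] at this
        exact π.symm this⟩
      trans := fun {u v z} h h' => ⟨π.trans h.1 h'.1, h.2.choose.trans h'.2.choose, fun i w =>
        π.trans (h.2.choose_spec i w) (h'.2.choose_spec i _)⟩ }

/-- The recursion does reach a fixed point. -/
theorem exists_fixed_refine (π : Setoid (Tuple n k)) :
    ∃ r, Function.IsFixedPt refine (refine^[r] π) := by
  have hanti : Antitone fun r => refine^[r] π := by
    refine antitone_nat_of_succ_le fun r => ?_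
    rw [Function.iterate_succ_apply']
    exact fun _ _ h => h.1
  have : Finite (Setoid (Tuple n k)) :=
    Finite.of_injective (fun s : Setoid (Tuple n k) => fun u v => s u v)
      fun s t h => Setoid.ext fun u v => iff_of_eq (congrFun (congrFun h u) v)
  obtain ⟨r, hr⟩ := WellFoundedGT.monotone_chain_condition (α := (Setoid (Tuple n k))ᵒᵈ)
    ⟨fun r => OrderDual.toDual (refine^[r] π), fun _ _ h => hanti h⟩
  refine ⟨r, ?_⟩
  have := hr (r + 1) (Nat.le_succ r)
  have h2 : refine^[r] π = refine^[r + 1] π := this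
  rw [Function.iterate_succ_apply'] at h2
  exact h2.symm

/-- The partition of the `k`-tuples that the algorithm computes for `G`. -/
noncomputable def stablePartition (G : SimpleGraph (Fin n)) (k : ℕ) : Setoid (Tuple n k) :=
  iterateToFixed refine (initial G k)

/-- The `k`-dimensional algorithm determines that `G` is asymmetric: the partition is complete,
that is, all of its cells are singletons. -/
def DeterminesAsymmetric (k : ℕ) (G : SimpleGraph (Fin n)) : Prop :=
  ∀ u v : Tuple n k, stablePartition G k u v → u = v

/-! #### Isomorphism algorithm: ordered partitions of the set of `k`-tuples

An ordered partition is given by its index function, which maps a tuple to the index (starting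
at `1`) of its cell. -/

/-- The index function of the ordered partition into the classes of equal `key`, in increasing
order of `key`. -/
noncomputable def index {α K : Type*} [Fintype α] [LinearOrder K] (key : α → K) (u : α) : ℕ :=
  ((Finset.univ.image key).filter (· ≤ key u)).card

/-- Let `key₁` and `key₂` be the keys by which two ordered partitions are being refined. The
refined ordered partitions have cells of the same sizes, and cells of the same index have the
same key. -/
def KeyEquiv {α K : Type*} [Fintype α] [LinearOrder K] (key₁ key₂ : α → K) : Prop :=
  (∀ s : ℕ, Nat.card {u // index key₁ u = s} = Nat.card {v // index key₂ v = s}) ∧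
  ∀ u v, key₁ u = key₂ v ↔ index key₁ u = index key₂ v

open Classical in
/-- The matrix of the subgraph type of `u`, as a row of rows, in lexicographic order. -/
noncomputable def typeMatrix (G : SimpleGraph (Fin n)) (u : Tuple n k) :
    Lex (Fin k → Lex (Fin k → ℤ)) :=
  toLex fun i => toLex fun j => if u i = u j then 0 else if G.Adj (u i) (u j) then 1 else -1

/-- The ordered partition of the `k`-tuples into subgraph types. -/
noncomputable def orderedInitial (G : SimpleGraph (Fin n)) (k : ℕ) : Tuple n k → ℕ :=
  index (typeMatrix G)

/-- The key of a tuple for subgraph types, with respect to an ordered partition `c`. -/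
noncomputable def typeKey (G : SimpleGraph (Fin n)) (c : Tuple n k → ℕ) (u : Tuple n k) :
    ℕ ×ₗ Lex (Fin k → Lex (Fin k → ℤ)) :=
  toLex (c u, typeMatrix G u)

/-- The key of a tuple `u` for the refinement step, with respect to an ordered partition `c`:
the index of `u`, followed by the list, sorted lexicographically, of the `n` vectors of indices
of the tuples that arise from `u` by replacing the `i`-th entry by `w`. -/
noncomputable def refineKey (c : Tuple n k → ℕ) (u : Tuple n k) :
    ℕ ×ₗ List (Lex (Fin k → ℕ)) :=
  toLex (c u, ((Finset.univ : Finset (Fin n)).val.map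
    fun w => toLex fun i => c (Function.update u i w)).sort (· ≤ ·))

/-- One refinement step for ordered partitions. -/
noncomputable def orderedRefine (c : Tuple n k → ℕ) : Tuple n k → ℕ :=
  index (refineKey c)

/-- The recursion does reach a fixed point. -/
theorem exists_fixed_orderedRefine (G : SimpleGraph (Fin n)) (k : ℕ) :
    ∃ r, Function.IsFixedPt orderedRefine (orderedRefine^[r] (orderedInitial G k)) := by
  -- indices weakly increase under refinement and are bounded
  have hidx : ∀ {K L : Type} [LinearOrder K] [LinearOrder L] (f : Tuple n k → K)
      (g : Tuple n k → L), (∀ u v, f u ≤ f v → g u ≤ g v) → index g ≤ index f := by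
    intro K L _ _ f g h u
    apply Finset.card_le_card_of_surjOn
      (fun x => if hx : ∃ v, f v = x then g hx.choose else g u)
    intro y hy
    simp only [Finset.coe_filter, Finset.mem_image, Finset.mem_univ, true_and,
      Set.mem_ofPred_eq] at hy
    obtain ⟨⟨v, rfl⟩, hv⟩ := hy
    by_cases hvu : f v ≤ f u
    · refine ⟨f v, by simpa using hvu, ?_⟩
      have hx : ∃ w, f w = f v := ⟨v, rfl⟩
      simp only [hx, dif_pos]
      exact le_antisymm (h _ _ hx.choose_spec.le) (h _ _ hx.choose_spec.ge)
    · refine ⟨f u, by simp, ?_⟩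
      have hx : ∃ w, f w = f u := ⟨u, rfl⟩
      simp only [hx, dif_pos]
      exact le_antisymm ((h _ _ (hx.choose_spec.le.trans (le_of_not_ge hvu))))
        (hv.trans (h _ _ hx.choose_spec.ge))
  have hle : ∀ {K : Type} [LinearOrder K] (f : Tuple n k → K) (u v), f u ≤ f v ↔
      index f u ≤ index f v := by
    intro K _ f u v
    constructor
    · intro h
      exact Finset.card_le_card fun x hx => by
        simp only [Finset.mem_filter] at hx ⊢
        exact ⟨hx.1, hx.2.trans h⟩
    · intro h
      by_contra h'
      have : index f v < index f u := Finset.card_lt_card (by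
        refine ⟨fun x hx => ?_, fun hs => ?_⟩
        · simp only [Finset.mem_filter] at hx ⊢
          exact ⟨hx.1, hx.2.trans (le_of_not_ge h')⟩
        · have := @hs (f u) (by simp)
          simp only [Finset.mem_filter] at this
          exact h' this.2)
      omega
  have hnorm : ∀ {K : Type} [LinearOrder K] (f : Tuple n k → K),
      index f ≤ orderedRefine (index f) := by
    intro K _ f
    refine hidx _ f fun u v h => (hle f u v).2 ?_
    have := Prod.Lex.toLex_le_toLex.1 h
    omega
  have hform : ∀ r, ∃ (K : Type) (_ : LinearOrder K) (f : Tuple n k → K),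
      orderedRefine^[r] (orderedInitial G k) = index f := by
    rintro (_ | r)
    · exact ⟨_, _, _, rfl⟩
    · exact ⟨_, _, refineKey _, by rw [Function.iterate_succ_apply']; rfl⟩
  have hmono : Monotone fun r => orderedRefine^[r] (orderedInitial G k) := by
    refine monotone_nat_of_le_succ fun r => ?_
    obtain ⟨K, _, f, hf⟩ := hform r
    rw [Function.iterate_succ_apply', hf]
    exact hnorm f
  let N := Fintype.card (Tuple n k)
  have hb : ∀ r u, orderedRefine^[r] (orderedInitial G k) u < N + 1 := by
    intro r u
    obtain ⟨K, _, f, hf⟩ := hform r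
    rw [hf]
    exact Nat.lt_succ_of_le ((Finset.card_filter_le _ _).trans Finset.card_image_le)
  obtain ⟨r, hr⟩ := WellFoundedGT.monotone_chain_condition (α := Tuple n k → Fin (N + 1))
    ⟨fun r u => ⟨_, hb r u⟩, fun _ _ h u => hmono h u⟩
  refine ⟨r, ?_⟩
  have h2 := hr (r + 1) (Nat.le_succ r)
  have h3 : orderedRefine^[r] (orderedInitial G k) = orderedRefine^[r + 1] (orderedInitial G k) :=
    funext fun u => congrArg Fin.val (congrFun h2 u)
  rw [Function.iterate_succ_apply'] at h3
  exact h3.symm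

/-- The ordered partition of the `k`-tuples that the algorithm computes for `G`. -/
noncomputable def orderedStablePartition (G : SimpleGraph (Fin n)) (k : ℕ) : Tuple n k → ℕ :=
  iterateToFixed orderedRefine (orderedInitial G k)

/-- The `k`-dimensional algorithm determines that `G` and `H` are not isomorphic: the ordered
partitions into subgraph types do not match, or the stable ordered partitions do not match. -/
def DeterminesNotIsomorphic (k : ℕ) (G H : SimpleGraph (Fin n)) : Prop :=
  ¬ (KeyEquiv (typeKey G (orderedInitial G k)) (typeKey H (orderedInitial H k)) ∧
     KeyEquiv (refineKey (orderedStablePartition G k)) (refineKey (orderedStablePartition H k)))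

end WeisfeilerLehman

/-! A point of the relaxation of level k+1 is a weight `y` on sets of at most k+1 vertex pairs:
nonnegative, with row and column sums that reproduce the weight of the smaller set, and zero on sets
that violate adjacency. The constraints with factors 1 - x follow from these
(`mem_relaxationQ_iff`).

From weights to Weisfeiler-Lehman: if `y (pairs u v)` is positive, the weights of its one-pair
extensions form a matrix with constant positive row and column sums. By Birkhoff's theorem its
support contains a permutation, and this is the bijection a refinement step asks for
(`exists_perm_update_pos`). So tuples joined by positive weight are never separated. Birkhoff's
theorem on the matrix indexed by k-tuples also gives a permutation of the tuples along which the
ordered partitions of G and H match.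

From Weisfeiler-Lehman to weights: matching stable partitions form an `IsMatching`. Weight a pair of
equally coloured families by the reciprocal of the size of the colour class. The number of
extensions of each colour is constant on a class, so the sums are consistent
(`IsMatching.isConsistent`). Two distinct equivalent tuples then give a positive off-diagonal entry.
Here k > 1 matters: tuples must see pairs of vertices. -/

/-! ### Square-free linearization -/

namespace SheraliAdams

open MvPolynomial

variable {σ : Type*}

/-- `linearize` as a linear map. -/
noncomputable def linearizeHom (y : Finset σ → ℝ) : MvPolynomial σ ℝ →ₗ[ℝ] ℝ :=
  (basisMonomials σ ℝ).constr ℝ fun m => y m.support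

theorem linearizeHom_monomial (y : Finset σ → ℝ) (m : σ →₀ ℕ) (c : ℝ) :
    linearizeHom y (monomial m c) = c * y m.support := by
  have h : monomial m c = c • basisMonomials σ ℝ m := by simp [smul_monomial]
  rw [h, map_smul, linearizeHom, Module.Basis.constr_basis, smul_eq_mul]

theorem linearize_eq (y : Finset σ → ℝ) (p : MvPolynomial σ ℝ) :
    linearize y p = linearizeHom y p := by
  conv_rhs => rw [p.as_sum, map_sum]
  simp only [linearizeHom_monomial, linearize]

variable [DecidableEq σ]

/-- Idempotence x² = x after linearization: a repeated variable does not change the support of a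
monomial. -/
theorem linearizeHom_insert (y : Finset σ → ℝ) (e : σ) (I : Finset σ) (q : MvPolynomial σ ℝ) :
    linearizeHom y (X e * ((∏ i ∈ I, X i) * q)) =
      linearizeHom y ((∏ i ∈ insert e I, X i) * q) := by
  by_cases he : e ∈ I
  · rw [Finset.insert_eq_of_mem he, ← Finset.mul_prod_erase _ _ he]
    generalize (∏ i ∈ I.erase e, X i : MvPolynomial σ ℝ) = p
    rw [mul_assoc]
    generalize p * q = r
    induction r using MvPolynomial.induction_on' with
    | monomial u a =>
      simp only [X, monomial_mul, linearizeHom_monomial, one_mul]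
      congr 2
      ext i
      simp [Finsupp.single_apply]
    | add p q hp hq => simp only [mul_add, map_add, hp, hq]
  · rw [Finset.prod_insert he, mul_assoc]

theorem linearizeHom_prod (y : Finset σ → ℝ) (I : Finset σ) :
    linearizeHom y (∏ i ∈ I, X i) = y I := by
  induction I using Finset.induction_on with
  | empty =>
    have : (1 : MvPolynomial σ ℝ) = monomial 0 1 := rfl
    rw [Finset.prod_empty, this, linearizeHom_monomial]
    simp
  | insert e I he ih =>
    have h : (∏ i ∈ I, X i : MvPolynomial σ ℝ) = monomial (∑ i ∈ I, Finsupp.single i 1) 1 := by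
      rw [monomial_sum_one]; rfl
    rw [Finset.prod_insert he, h, X, monomial_mul, linearizeHom_monomial]
    simp only [mul_one, one_mul]
    congr 1
    ext i
    simp [Finsupp.single_apply, Finset.sum_ite_eq, eq_comm]
    tauto

theorem linearizeHom_prod_mul_X (y : Finset σ → ℝ) (I : Finset σ) (e : σ) :
    linearizeHom y ((∏ i ∈ I, X i) * X e) = y (insert e I) := by
  have := linearizeHom_insert y e I 1
  rw [mul_one, mul_one, linearizeHom_prod] at this
  rw [mul_comm, this]

end SheraliAdams

/-! ### The relaxation as consistent weights on sets of pairs -/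

namespace GraphIso

open MvPolynomial SheraliAdams

variable {n : ℕ}

/-- The constraints of the Sherali-Adams relaxation, in terms of the numbers `y I`. -/
structure IsConsistent (k : ℕ) (G H : SimpleGraph (Fin n))
    (y : Finset (Fin n × Fin n) → ℝ) : Prop where
  empty : y ∅ = 1
  nonneg : ∀ I, I.card ≤ k + 1 → 0 ≤ y I
  row_sum : ∀ I, I.card ≤ k → ∀ u, ∑ w, y (insert (u, w) I) = y I
  col_sum : ∀ I, I.card ≤ k → ∀ v, ∑ w, y (insert (w, v) I) = y I
  eq_zero : ∀ I, I.card ≤ k → ∀ u₁ u₂ v₁ v₂, ¬ (G.Adj u₁ u₂ ↔ H.Adj v₁ v₂) →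
    y (insert (u₂, v₂) (insert (u₁, v₁) I)) = 0

theorem isConsistent_of_isExtendedPoint {k : ℕ} {G H : SimpleGraph (Fin n)}
    {y : Finset (Fin n × Fin n) → ℝ} (h : IsExtendedPoint (k + 1) (equations G H) ∅ y) :
    IsConsistent k G H y where
  empty := h.empty_eq_one
  nonneg I hI := by
    have := h.box_nonneg I I subset_rfl hI
    rwa [boxFactor, Finset.sdiff_self, Finset.prod_empty, mul_one, linearize_eq,
      linearizeHom_prod] at this
  row_sum I hI u := by
    have := h.eq_zero ((∑ w, X (u, w)) - 1) (Or.inl (Or.inl (Or.inl ⟨u, rfl⟩))) I (by omega)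
    rw [linearize_eq, mul_sub, Finset.mul_sum, map_sub, map_sum, mul_one, linearizeHom_prod] at this
    simp only [linearizeHom_prod_mul_X] at this
    linarith
  col_sum I hI v := by
    have := h.eq_zero ((∑ w, X (w, v)) - 1) (Or.inl (Or.inl (Or.inr ⟨v, rfl⟩))) I (by omega)
    rw [linearize_eq, mul_sub, Finset.mul_sum, map_sub, map_sum, mul_one, linearizeHom_prod] at this
    simp only [linearizeHom_prod_mul_X] at this
    linarith
  eq_zero I hI u₁ u₂ v₁ v₂ hne := by
    have := h.eq_zero (X (u₁, v₁) * X (u₂, v₂)) (by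
      by_cases hG : G.Adj u₁ u₂
      · exact Or.inl (Or.inr ⟨u₁, u₂, v₁, v₂, hG, by tauto, rfl⟩)
      · exact Or.inr ⟨u₁, u₂, v₁, v₂, hG, by tauto, rfl⟩) I (by omega)
    rwa [linearize_eq, mul_left_comm, linearizeHom_insert, linearizeHom_prod_mul_X] at this

namespace IsConsistent

variable {k : ℕ} {G H : SimpleGraph (Fin n)} {y : Finset (Fin n × Fin n) → ℝ}

/-- Splitting 1 - x into its two terms reduces to row equations for `I` and for `I` with one more
pair, so each factor costs one unit of the degree bound. -/
theorem linearizeHom_row (h : IsConsistent k G H y) (u : Fin n) (T : Finset (Fin n × Fin n)) :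
    ∀ I : Finset (Fin n × Fin n), I.card + T.card ≤ k →
      linearizeHom y ((∏ i ∈ I, X i) * ((∏ i ∈ T, (1 - X i)) * ((∑ w, X (u, w)) - 1))) = 0 := by
  induction T using Finset.induction_on with
  | empty =>
    intro I hI
    rw [Finset.prod_empty, one_mul, mul_sub, Finset.mul_sum, map_sub, map_sum, mul_one,
      linearizeHom_prod]
    simp only [linearizeHom_prod_mul_X]
    rw [h.row_sum I (by simpa using hI), sub_self]
  | insert e T he ih =>
    intro I hI
    rw [Finset.card_insert_of_notMem he] at hI
    rw [Finset.prod_insert he, mul_assoc, sub_mul, one_mul, mul_sub, map_sub, ih I (by omega),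
      mul_left_comm, linearizeHom_insert,
      ih _ (by have := Finset.card_insert_le e I; omega), sub_zero]

/-- Modulo the row equation, 1 - x at (u, v) is the sum of the other variables of row u.
Complemented factors can thus be traded for plain variables one at a time. -/
theorem linearizeHom_box_nonneg (h : IsConsistent k G H y) (T : Finset (Fin n × Fin n)) :
    ∀ I : Finset (Fin n × Fin n), I.card + T.card ≤ k + 1 →
      0 ≤ linearizeHom y ((∏ i ∈ I, X i) * ∏ i ∈ T, (1 - X i)) := by
  induction T using Finset.induction_on with
  | empty =>
    intro I hI
    rw [Finset.prod_empty, mul_one, linearizeHom_prod]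
    exact h.nonneg I (by simpa using hI)
  | insert e T he ih =>
    intro I hI
    rw [Finset.card_insert_of_notMem he] at hI
    have hrow := h.linearizeHom_row e.1 T I (by omega)
    have key : linearizeHom y ((∏ i ∈ I, X i) * ∏ i ∈ insert e T, (1 - X i)) =
        ∑ w ∈ Finset.univ.erase e.2,
          linearizeHom y ((∏ i ∈ insert (e.1, w) I, X i) * ∏ i ∈ T, (1 - X i)) := by
      simp only [← linearizeHom_insert]
      -- The difference of the two sides is minus the multiplied row equation `hrow`.
      rw [← map_sum, ← sub_eq_zero, ← map_sub, ← neg_eq_zero, ← map_neg, ← hrow,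
        ← Finset.add_sum_erase _ _ (Finset.mem_univ e.2), Finset.prod_insert he,
        ← Finset.sum_mul]
      congr 1
      ring
    rw [key]
    exact Finset.sum_nonneg fun w _ => ih _ (by
      have := Finset.card_insert_le (e.1, w) I; omega)

theorem isExtendedPoint (h : IsConsistent k G H y) :
    IsExtendedPoint (k + 1) (equations G H) ∅ y where
  empty_eq_one := h.empty
  eq_zero f hf I hI := by
    have hI : I.card ≤ k := by omega
    rw [linearize_eq]
    rcases hf with ((⟨u, rfl⟩ | ⟨v, rfl⟩) | ⟨u₁, u₂, v₁, v₂, hG, hH, rfl⟩) |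
      ⟨u₁, u₂, v₁, v₂, hG, hH, rfl⟩
    · rw [mul_sub, Finset.mul_sum, map_sub, map_sum, mul_one, linearizeHom_prod]
      simp only [linearizeHom_prod_mul_X]
      rw [h.row_sum I hI, sub_self]
    · rw [mul_sub, Finset.mul_sum, map_sub, map_sum, mul_one, linearizeHom_prod]
      simp only [linearizeHom_prod_mul_X]
      rw [h.col_sum I hI, sub_self]
    all_goals
      rw [mul_left_comm, linearizeHom_insert, linearizeHom_prod_mul_X]
      exact h.eq_zero I hI _ _ _ _ (by tauto)
  ineq_nonneg g hg := hg.elim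
  box_nonneg I J hIJ hJ := by
    rw [linearize_eq]
    refine h.linearizeHom_box_nonneg (J \ I) I ?_
    rw [Finset.card_sdiff_of_subset hIJ]
    have := Finset.card_le_card hIJ
    omega

end IsConsistent

theorem mem_relaxationQ_iff {k : ℕ} {G H : SimpleGraph (Fin n)} {M : Matrix (Fin n) (Fin n) ℝ} :
    M ∈ relaxationQ (k + 1) G H ↔ ∃ y, IsConsistent k G H y ∧ ∀ u v, M u v = y {(u, v)} :=
  ⟨fun ⟨y, hy, h⟩ => ⟨y, isConsistent_of_isExtendedPoint hy, fun u v => h (u, v)⟩,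
    fun ⟨y, hy, h⟩ => ⟨y, hy.isExtendedPoint, fun e => h e.1 e.2⟩⟩

end GraphIso

/-! ### Birkhoff's theorem and positive weights -/

/-- After scaling, the matrix is a convex combination of permutation matrices; any permutation with
nonzero coefficient lies in the support. -/
theorem Matrix.exists_perm_pos {m : Type*} [Fintype m] [DecidableEq m] {A : Matrix m m ℝ} {s : ℝ}
    (hs : 0 < s) (h0 : ∀ i j, 0 ≤ A i j) (hr : ∀ i, ∑ j, A i j = s) (hc : ∀ j, ∑ i, A i j = s) :
    ∃ π : Equiv.Perm m, ∀ i, 0 < A i (π i) := by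
  obtain ⟨B, hB, rfl⟩ := (exists_mem_doublyStochastic_eq_smul_iff hs.le).2 ⟨h0, hr, hc⟩
  obtain ⟨w, hw0, hw1, rfl⟩ := exists_eq_sum_perm_of_mem_doublyStochastic hB
  obtain ⟨π, -, hπ⟩ := Finset.exists_ne_zero_of_sum_ne_zero (by rw [hw1]; exact one_ne_zero)
  refine ⟨π, fun i => ?_⟩
  rw [Matrix.smul_apply, smul_eq_mul, Matrix.sum_apply]
  refine mul_pos hs (Finset.sum_pos' (fun τ _ => ?_) ⟨π, Finset.mem_univ _, ?_⟩)
  · rw [Matrix.smul_apply, smul_eq_mul, Equiv.Perm.permMatrix, PEquiv.toMatrix_apply]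
    exact mul_nonneg (hw0 τ) (by split_ifs <;> norm_num)
  · have : w π > 0 := lt_of_le_of_ne (hw0 π) hπ.symm
    simpa [Equiv.Perm.permMatrix, PEquiv.toMatrix_apply] using this

namespace GraphIso

variable {n : ℕ}

/-- The set of pairs of corresponding entries of two families of vertices. -/
def pairs {ι : Type*} [Fintype ι] (a b : ι → Fin n) : Finset (Fin n × Fin n) :=
  Finset.univ.image fun i => (a i, b i)

theorem card_pairs_le {ι : Type*} [Fintype ι] (a b : ι → Fin n) :
    (pairs a b).card ≤ Fintype.card ι :=
  Finset.card_image_le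

theorem mk_mem_pairs {ι : Type*} [Fintype ι] (a b : ι → Fin n) (i : ι) :
    (a i, b i) ∈ pairs a b :=
  Finset.mem_image_of_mem _ (Finset.mem_univ i)

theorem pairs_cons {m : ℕ} (w w' : Fin n) (a b : Fin m → Fin n) :
    pairs (Fin.cons w a : Fin (m + 1) → Fin n) (Fin.cons w' b : Fin (m + 1) → Fin n) =
      insert (w, w') (pairs a b) := by
  ext p
  simp [pairs, Fin.exists_fin_succ, eq_comm]

/-- Replacing an entry means adding a pair and possibly forgetting one. This is why level k+1
corresponds to dimension k. -/
theorem pairs_update_subset {k : ℕ} (u v : Fin k → Fin n) (i : Fin k) (w w' : Fin n) :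
    pairs (Function.update u i w) (Function.update v i w') ⊆ insert (w, w') (pairs u v) := by
  intro p hp
  obtain ⟨j, -, rfl⟩ := Finset.mem_image.1 hp
  by_cases hj : j = i
  · subst hj
    simp
  · simp only [Function.update_of_ne hj]
    exact Finset.mem_insert_of_mem (mk_mem_pairs u v j)

namespace IsConsistent

variable {k : ℕ} {G H : SimpleGraph (Fin n)} {y : Finset (Fin n × Fin n) → ℝ}

theorem nonneg_insert (h : IsConsistent k G H y) {I : Finset (Fin n × Fin n)} (hI : I.card ≤ k)
    (e : Fin n × Fin n) : 0 ≤ y (insert e I) :=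
  h.nonneg _ ((Finset.card_insert_le e I).trans (by omega))

theorem insert_le (h : IsConsistent k G H y) {I : Finset (Fin n × Fin n)} (hI : I.card ≤ k)
    (e : Fin n × Fin n) : y (insert e I) ≤ y I := by
  rw [← h.row_sum I hI e.1]
  exact Finset.single_le_sum (f := fun w => y (insert (e.1, w) I))
    (fun w _ => h.nonneg_insert hI _) (Finset.mem_univ e.2)

theorem union_le (h : IsConsistent k G H y) (I T : Finset (Fin n × Fin n))
    (hc : (I ∪ T).card ≤ k + 1) : y (I ∪ T) ≤ y I := by
  induction T using Finset.induction_on with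
  | empty => simp
  | insert e T _ ih =>
    rw [Finset.union_insert] at hc ⊢
    by_cases he : e ∈ I ∪ T
    · rw [Finset.insert_eq_of_mem he] at hc ⊢
      exact ih hc
    · rw [Finset.card_insert_of_notMem he] at hc
      exact (h.insert_le (by omega) e).trans (ih (by omega))

theorem anti (h : IsConsistent k G H y) {I J : Finset (Fin n × Fin n)} (hIJ : I ⊆ J)
    (hJ : J.card ≤ k + 1) : y J ≤ y I := by
  have := h.union_le I J (by rwa [Finset.union_eq_right.2 hIJ])
  rwa [Finset.union_eq_right.2 hIJ] at this

theorem adj_iff (h : IsConsistent k G H y) {I : Finset (Fin n × Fin n)} (hI : I.card ≤ k)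
    (hy : 0 < y I) {p q : Fin n × Fin n} (hp : p ∈ I) (hq : q ∈ I) :
    G.Adj p.1 q.1 ↔ H.Adj p.2 q.2 := by
  by_contra hne
  have := h.eq_zero I hI p.1 q.1 p.2 q.2 hne
  rw [Finset.insert_eq_of_mem (Finset.mem_insert_of_mem hq), Finset.insert_eq_of_mem hp] at this
  exact hy.ne' this

/-- Two pairs of `I` in one row but different columns would each contribute `y I` to a row sum equal
to `y I`. -/
theorem snd_eq (h : IsConsistent k G H y) {I : Finset (Fin n × Fin n)} (hI : I.card ≤ k)
    (hy : 0 < y I) {p q : Fin n × Fin n} (hp : p ∈ I) (hq : q ∈ I) (hpq : p.1 = q.1) :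
    p.2 = q.2 := by
  by_contra hne
  have hsum := h.row_sum I hI p.1
  have := Finset.add_le_sum (f := fun w => y (insert (p.1, w) I))
    (fun w _ => h.nonneg_insert hI _) (Finset.mem_univ p.2) (Finset.mem_univ q.2) hne
  rw [hsum, Finset.insert_eq_of_mem hp, hpq, Finset.insert_eq_of_mem hq] at this
  linarith

theorem fst_eq (h : IsConsistent k G H y) {I : Finset (Fin n × Fin n)} (hI : I.card ≤ k)
    (hy : 0 < y I) {p q : Fin n × Fin n} (hp : p ∈ I) (hq : q ∈ I) (hpq : p.2 = q.2) :
    p.1 = q.1 := by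
  by_contra hne
  have hsum := h.col_sum I hI p.2
  have := Finset.add_le_sum (f := fun w => y (insert (w, p.2) I))
    (fun w _ => h.nonneg_insert hI _) (Finset.mem_univ p.1) (Finset.mem_univ q.1) hne
  rw [hsum, Finset.insert_eq_of_mem hp, hpq, Finset.insert_eq_of_mem hq] at this
  linarith

theorem exists_perm_insert_pos (h : IsConsistent k G H y) {I : Finset (Fin n × Fin n)}
    (hI : I.card ≤ k) (hy : 0 < y I) :
    ∃ ψ : Equiv.Perm (Fin n), ∀ w, 0 < y (insert (w, ψ w) I) :=
  Matrix.exists_perm_pos (A := fun u v => y (insert (u, v) I)) hy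
    (fun _ _ => h.nonneg_insert hI _) (h.row_sum I hI) (h.col_sum I hI)

theorem card_tuple_pairs_le (u v : Fin k → Fin n) : (pairs u v).card ≤ k :=
  (card_pairs_le u v).trans (Fintype.card_fin k).le

theorem eq_iff_of_pos (h : IsConsistent k G H y) {u v : Fin k → Fin n} (hy : 0 < y (pairs u v))
    (i j : Fin k) : u i = u j ↔ v i = v j :=
  ⟨h.snd_eq (card_tuple_pairs_le u v) hy (mk_mem_pairs u v i) (mk_mem_pairs u v j),
    h.fst_eq (card_tuple_pairs_le u v) hy (mk_mem_pairs u v i) (mk_mem_pairs u v j)⟩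

theorem adj_iff_of_pos (h : IsConsistent k G H y) {u v : Fin k → Fin n} (hy : 0 < y (pairs u v))
    (i j : Fin k) : G.Adj (u i) (u j) ↔ H.Adj (v i) (v j) :=
  h.adj_iff (card_tuple_pairs_le u v) hy (mk_mem_pairs u v i) (mk_mem_pairs u v j)

theorem exists_perm_update_pos (h : IsConsistent k G H y) {u v : Fin k → Fin n}
    (hy : 0 < y (pairs u v)) : ∃ ψ : Equiv.Perm (Fin n), ∀ (i : Fin k) (w : Fin n),
      0 < y (pairs (Function.update u i w) (Function.update v i (ψ w))) := by
  obtain ⟨ψ, hψ⟩ := h.exists_perm_insert_pos (card_tuple_pairs_le u v) hy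
  exact ⟨ψ, fun i w => (hψ w).trans_le (h.anti (pairs_update_subset u v i w (ψ w))
    ((Finset.card_insert_le _ _).trans (Nat.succ_le_succ (card_tuple_pairs_le u v))))⟩

theorem sum_pairs_right (h : IsConsistent k G H y) {m : ℕ} (hm : m ≤ k) (a : Fin m → Fin n) :
    ∑ b : Fin m → Fin n, y (pairs a b) = 1 := by
  induction m with
  | zero => simp [pairs, h.empty]
  | succ m ih =>
    rw [← (Fin.consEquiv fun _ => Fin n).sum_comp, Fintype.sum_prod_type_right,
      ← ih (by omega) (Fin.tail a)]
    refine Finset.sum_congr rfl fun b _ => ?_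
    rw [← h.row_sum _ ((card_pairs_le _ _).trans (by simp; omega)) (a 0)]
    refine Finset.sum_congr rfl fun w _ => ?_
    rw [← pairs_cons, Fin.cons_self_tail]
    rfl

theorem sum_pairs_left (h : IsConsistent k G H y) {m : ℕ} (hm : m ≤ k) (b : Fin m → Fin n) :
    ∑ a : Fin m → Fin n, y (pairs a b) = 1 := by
  induction m with
  | zero => simp [pairs, h.empty]
  | succ m ih =>
    rw [← (Fin.consEquiv fun _ => Fin n).sum_comp, Fintype.sum_prod_type_right,
      ← ih (by omega) (Fin.tail b)]
    refine Finset.sum_congr rfl fun a _ => ?_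
    rw [← h.col_sum _ ((card_pairs_le _ _).trans (by simp; omega)) (b 0)]
    refine Finset.sum_congr rfl fun w _ => ?_
    rw [← pairs_cons, Fin.cons_self_tail]
    rfl

theorem exists_tuple_perm (h : IsConsistent k G H y) :
    ∃ Ψ : Equiv.Perm (Fin k → Fin n), ∀ u, 0 < y (pairs u (Ψ u)) :=
  Matrix.exists_perm_pos (A := fun u v => y (pairs u v)) one_pos
    (fun u v => h.nonneg _ ((card_tuple_pairs_le u v).trans (by omega)))
    (h.sum_pairs_right le_rfl) (h.sum_pairs_left le_rfl)

end IsConsistent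

end GraphIso

/-! ### Positive weight prevents separation by the algorithm -/

namespace WeisfeilerLehman

open GraphIso

variable {n k : ℕ}

theorem _root_.GraphIso.IsConsistent.stablePartition {G : SimpleGraph (Fin n)}
    {y : Finset (Fin n × Fin n) → ℝ} (h : IsConsistent k G G y) {u v : Tuple n k}
    (hy : 0 < y (pairs u v)) : stablePartition G k u v := by
  rw [WeisfeilerLehman.stablePartition, iterateToFixed]
  -- The claim holds after any number of rounds, so the stopping time is irrelevant.
  generalize sInf {r | Function.IsFixedPt refine (refine^[r] (initial G k))} = r
  induction r generalizing u v with
  | zero => exact ⟨h.eq_iff_of_pos hy, h.adj_iff_of_pos hy⟩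
  | succ r ih =>
    rw [Function.iterate_succ_apply']
    obtain ⟨ψ, hψ⟩ := h.exists_perm_update_pos hy
    exact ⟨ih hy, ψ, fun i w => ih (hψ i w)⟩

/-- A positive off-diagonal entry would put two different constant tuples into one cell; row sums
then force the diagonal to be 1. -/
theorem eq_one_of_determinesAsymmetric {G : SimpleGraph (Fin n)} (hk : 0 < k)
    (hG : DeterminesAsymmetric k G) {M : Matrix (Fin n) (Fin n) ℝ}
    (hM : M ∈ relaxationQ (k + 1) G G) : M = 1 := by
  obtain ⟨y, h, hMy⟩ := mem_relaxationQ_iff.1 hM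
  have hpairs : ∀ u v : Fin n, pairs (fun _ : Fin k => u) (fun _ => v) = {(u, v)} := by
    intro u v
    have : Nonempty (Fin k) := ⟨⟨0, hk⟩⟩
    ext p
    simp [pairs, eq_comm]
  have hoff : ∀ u v, u ≠ v → y {(u, v)} = 0 := by
    intro u v huv
    by_contra hne
    have hpos := lt_of_le_of_ne (h.nonneg {(u, v)} (by simp)) (Ne.symm hne)
    rw [← hpairs] at hpos
    exact huv (congrFun (hG _ _ (h.stablePartition hpos)) ⟨0, hk⟩)
  ext u v
  rw [hMy]
  by_cases huv : u = v
  · subst huv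
    rw [Matrix.one_apply_eq]
    have := h.row_sum ∅ (by simp) u
    simp only [insert_empty_eq] at this
    rw [Finset.sum_eq_single u (fun w _ hw => hoff u w hw.symm) (by simp), h.empty] at this
    exact this
  · rw [Matrix.one_apply_ne huv, hoff u v huv]

/-! #### Index functions -/

theorem index_eq_of_image_eq {α β K : Type*} [Fintype α] [Fintype β] [LinearOrder K]
    {key₁ : α → K} {key₂ : β → K} (h : Set.range key₁ = Set.range key₂)
    {u : α} {v : β} (huv : key₁ u = key₂ v) : index key₁ u = index key₂ v := by
  have : Finset.univ.image key₁ = Finset.univ.image key₂ := by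
    rw [← Finset.coe_inj]
    simpa using h
  rw [index, index, this, huv]

theorem index_lt_iff {α K : Type*} [Fintype α] [LinearOrder K] {key : α → K} {u v : α} :
    index key u < index key v ↔ key u < key v := by
  have hmono : ∀ {u v}, key u ≤ key v → index key u ≤ index key v := fun h =>
    Finset.card_le_card fun x hx => by
      simp only [Finset.mem_filter] at hx ⊢
      exact ⟨hx.1, hx.2.trans h⟩
  refine ⟨fun h => lt_of_not_ge fun h' => (hmono h').not_gt h, fun h => Finset.card_lt_card ?_⟩
  refine Finset.ssubset_iff_of_subset (fun x hx => ?_) |>.2 ⟨key v, by simp, by simpa using h⟩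
  simp only [Finset.mem_filter] at hx ⊢
  exact ⟨hx.1, hx.2.trans h.le⟩

theorem index_eq_iff {α K : Type*} [Fintype α] [LinearOrder K] {key : α → K} {u v : α} :
    index key u = index key v ↔ key u = key v := by
  rw [← not_iff_not, ← ne_eq, ← ne_eq, ne_iff_lt_or_gt, ne_iff_lt_or_gt]
  exact or_congr index_lt_iff index_lt_iff

theorem range_eq_of_perm {α K : Type*} {key₁ key₂ : α → K}
    (Ψ : Equiv.Perm α) (h : ∀ u, key₁ u = key₂ (Ψ u)) : Set.range key₁ = Set.range key₂ := by
  rw [show key₁ = key₂ ∘ Ψ from funext h, Ψ.surjective.range_comp]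

theorem keyEquiv_of_perm {α K : Type*} [Fintype α] [LinearOrder K] {key₁ key₂ : α → K}
    (Ψ : Equiv.Perm α) (h : ∀ u, key₁ u = key₂ (Ψ u)) : KeyEquiv key₁ key₂ := by
  have hi : ∀ u, index key₁ u = index key₂ (Ψ u) := fun u =>
    index_eq_of_image_eq (range_eq_of_perm Ψ h) (h u)
  exact ⟨fun s => Nat.card_congr (Ψ.subtypeEquiv fun u => by rw [hi u]),
    fun u v => by rw [h, hi, index_eq_iff]⟩

theorem exists_perm_of_card_fiber_eq {α K : Type*} [Finite α] {f g : α → K}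
    (h : ∀ s, Nat.card {a // f a = s} = Nat.card {a // g a = s}) :
    ∃ π : Equiv.Perm α, ∀ a, f a = g (π a) :=
  ⟨Equiv.ofFiberEquiv fun s => (Finite.card_eq.1 (h s)).some,
    fun a => (Equiv.ofFiberEquiv_map _ a).symm⟩

theorem map_univ_val_eq_iff {α K : Type*} [Fintype α] {f g : α → K} :
    (Finset.univ : Finset α).val.map f = (Finset.univ : Finset α).val.map g ↔
      ∃ π : Equiv.Perm α, f = g ∘ π := by
  classical
  constructor
  · intro h
    obtain ⟨π, hπ⟩ := exists_perm_of_card_fiber_eq (f := f) (g := g) fun s => by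
      have := congrArg (Multiset.count s) h
      simp only [Multiset.count_map, ← Finset.filter_val, Finset.card_val] at this
      simpa [Fintype.card_subtype, eq_comm] using this
    exact ⟨π, funext hπ⟩
  · rintro ⟨π, rfl⟩
    rw [← Multiset.map_map, Multiset.map_univ_val_equiv]

/-- Equal sorted lists are equal multisets, hence reindexings of each other: the bijection of the
unordered algorithm reappears. -/
theorem refineKey_eq_iff {c c' : Tuple n k → ℕ} {u v : Tuple n k} :
    refineKey c u = refineKey c' v ↔ c u = c' v ∧ ∃ ψ : Equiv.Perm (Fin n),
      ∀ (i : Fin k) (w : Fin n),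
        c (Function.update u i w) = c' (Function.update v i (ψ w)) := by
  have hs : ∀ s t : Multiset (Lex (Fin k → ℕ)), s.sort (· ≤ ·) = t.sort (· ≤ ·) ↔ s = t :=
    fun s t => ⟨fun h => by rw [← Multiset.sort_eq s (· ≤ ·), h, Multiset.sort_eq],
      fun h => h ▸ rfl⟩
  rw [refineKey, refineKey, toLex_inj, Prod.mk.injEq, hs, map_univ_val_eq_iff]
  refine and_congr_right fun _ => exists_congr fun ψ => ?_
  rw [funext_iff, forall_comm]
  refine forall_congr' fun w => ?_
  rw [Function.comp_apply, toLex_inj, funext_iff]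

theorem typeMatrix_eq_iff {G H : SimpleGraph (Fin n)} {u v : Tuple n k} :
    typeMatrix G u = typeMatrix H v ↔
      (∀ i j, u i = u j ↔ v i = v j) ∧ ∀ i j, G.Adj (u i) (u j) ↔ H.Adj (v i) (v j) := by
  rw [typeMatrix, typeMatrix, toLex_inj, funext_iff, ← forall_and]
  refine forall_congr' fun i => ?_
  rw [toLex_inj, funext_iff, ← forall_and]
  refine forall_congr' fun j => ?_
  have hG : u i = u j → ¬ G.Adj (u i) (u j) := fun h h' => h'.ne h
  have hH : v i = v j → ¬ H.Adj (v i) (v j) := fun h h' => h'.ne h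
  split_ifs <;> simp_all

/-- An index is a rank among the attained keys. The tuple permutation `Ψ` shows that both graphs
attain the same keys, so ranks can be compared across graphs. -/
theorem _root_.GraphIso.IsConsistent.iterate_eq {G H : SimpleGraph (Fin n)}
    {y : Finset (Fin n × Fin n) → ℝ} (h : IsConsistent k G H y) (r : ℕ) {u v : Tuple n k}
    (hy : 0 < y (pairs u v)) :
    orderedRefine^[r] (orderedInitial G k) u = orderedRefine^[r] (orderedInitial H k) v := by
  obtain ⟨Ψ, hΨ⟩ := h.exists_tuple_perm
  induction r generalizing u v with
  | zero =>
    have hkey : ∀ {u v : Tuple n k}, 0 < y (pairs u v) → typeMatrix G u = typeMatrix H v :=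
      fun hy => typeMatrix_eq_iff.2 ⟨h.eq_iff_of_pos hy, h.adj_iff_of_pos hy⟩
    exact index_eq_of_image_eq (range_eq_of_perm Ψ fun u => hkey (hΨ u)) (hkey hy)
  | succ r ih =>
    rw [Function.iterate_succ_apply', Function.iterate_succ_apply']
    have hkey : ∀ {u v : Tuple n k}, 0 < y (pairs u v) →
        refineKey (orderedRefine^[r] (orderedInitial G k)) u =
          refineKey (orderedRefine^[r] (orderedInitial H k)) v := by
      intro u v hy
      obtain ⟨ψ, hψ⟩ := h.exists_perm_update_pos hy
      exact refineKey_eq_iff.2 ⟨ih hy, ψ, fun i w => ih (hψ i w)⟩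
    exact index_eq_of_image_eq (range_eq_of_perm Ψ fun u => hkey (hΨ u)) (hkey hy)

theorem _root_.GraphIso.IsConsistent.orderedStablePartition_eq {G H : SimpleGraph (Fin n)}
    {y : Finset (Fin n × Fin n) → ℝ} (h : IsConsistent k G H y) {u v : Tuple n k}
    (hy : 0 < y (pairs u v)) :
    orderedStablePartition G k u = orderedStablePartition H k v := by
  obtain ⟨Ψ, hΨ⟩ := h.exists_tuple_perm
  -- Both runs stop in the same round, since `Ψ` carries one index function to the other.
  have hfix : ∀ r, Function.IsFixedPt orderedRefine (orderedRefine^[r] (orderedInitial G k)) ↔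
      Function.IsFixedPt orderedRefine (orderedRefine^[r] (orderedInitial H k)) := by
    intro r
    rw [Function.IsFixedPt, Function.IsFixedPt, ← Function.iterate_succ_apply' orderedRefine,
      ← Function.iterate_succ_apply' orderedRefine, funext_iff, funext_iff]
    refine Ψ.forall_congr fun {u} => ?_
    rw [h.iterate_eq _ (hΨ u), h.iterate_eq _ (hΨ u)]
  rw [orderedStablePartition, orderedStablePartition, iterateToFixed, iterateToFixed]
  simp only [hfix]
  exact h.iterate_eq _ hy

theorem not_determinesNotIsomorphic_of_isConsistent {G H : SimpleGraph (Fin n)}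
    {y : Finset (Fin n × Fin n) → ℝ} (h : IsConsistent k G H y) :
    ¬ DeterminesNotIsomorphic k G H := by
  obtain ⟨Ψ, hΨ⟩ := h.exists_tuple_perm
  refine not_not_intro ⟨keyEquiv_of_perm Ψ fun u => ?_, keyEquiv_of_perm Ψ fun u => ?_⟩
  · rw [typeKey, typeKey, toLex_inj]
    exact Prod.ext (h.iterate_eq 0 (hΨ u))
      (typeMatrix_eq_iff.2 ⟨h.eq_iff_of_pos (hΨ u), h.adj_iff_of_pos (hΨ u)⟩)
  · obtain ⟨ψ, hψ⟩ := h.exists_perm_update_pos (hΨ u)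
    exact refineKey_eq_iff.2 ⟨h.orderedStablePartition_eq (hΨ u), ψ, fun i w =>
      h.orderedStablePartition_eq (hψ i w)⟩

end WeisfeilerLehman

/-! ### Consistent weights from a matching of tuples -/

namespace WeisfeilerLehman

open GraphIso

variable {n k : ℕ}

/-- A pair of colourings of the `k`-tuples of two graphs, by which the tuples of the two graphs
are matched in a way that is compatible with one-vertex extensions and with substitutions. -/
structure IsMatching {K : Type*} (G H : SimpleGraph (Fin n)) (c d : Tuple n k → K) : Prop where
  card_eq : ∀ s, Nat.card {u // c u = s} = Nat.card {v // d v = s}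
  eq_iff : ∀ {u v}, c u = d v → ∀ i j, u i = u j ↔ v i = v j
  adj_iff : ∀ {u v}, c u = d v → ∀ i j, G.Adj (u i) (u j) ↔ H.Adj (v i) (v j)
  exists_perm : ∀ {u v}, c u = d v → ∃ ψ : Equiv.Perm (Fin n), ∀ (i : Fin k) (w : Fin n),
    c (Function.update u i w) = d (Function.update v i (ψ w))
  comp : ∀ {u v}, c u = d v → ∀ f : Fin k → Fin k, c (u ∘ f) = d (v ∘ f)

/-- The colour of a family of vertices: the colours of all `k`-tuples of members. -/
def famColour {K ι : Type*} (c : Tuple n k → K) (a : ι → Fin n) : (Fin k → ι) → K :=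
  fun f => c (a ∘ f)

/-- The family `a` with one more vertex `w`. -/
def extend {ι : Type*} (w : Fin n) (a : ι → Fin n) : Option ι → Fin n :=
  fun o => o.elim w a

/-- The number of families of vertices of a given colour. -/
noncomputable def classCard {K ι : Type*} (d : Tuple n k → K) (s : (Fin k → ι) → K) : ℕ :=
  Nat.card {b : ι → Fin n // famColour d b = s}

open Classical in
/-- The probability that the family `b` is chosen among those of the same colour as `a`. -/
noncomputable def weight {K ι : Type*} (c d : Tuple n k → K) (a b : ι → Fin n) : ℝ :=
  if famColour c a = famColour d b then (classCard d (famColour d b) : ℝ)⁻¹ else 0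

theorem famColour_comp {K ι ι' : Type*} {c d : Tuple n k → K} {a b : ι → Fin n}
    (h : famColour c a = famColour d b) (g : ι' → ι) :
    famColour c (a ∘ g) = famColour d (b ∘ g) :=
  funext fun f => congrFun h (g ∘ f)

theorem famColour_of_comp {K ι ι' : Type*} {c d : Tuple n k → K} {a b : ι → Fin n} {g : ι' → ι}
    (hg : g.Surjective) (h : famColour c (a ∘ g) = famColour d (b ∘ g)) :
    famColour c a = famColour d b := by
  obtain ⟨s, hs⟩ := hg.hasRightInverse
  have h' := famColour_comp h s
  rwa [Function.comp_assoc, Function.comp_assoc, hs.comp_eq_id, Function.comp_id,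
    Function.comp_id] at h'

namespace IsMatching

variable {K ι : Type*} {G H : SimpleGraph (Fin n)} {c d : Tuple n k → K}

/-- Equality patterns are preserved, so a colour-preserving permutation of tuples maps constant
tuples to constant tuples. This covers extensions of the empty family. -/
theorem exists_perm_const (m : IsMatching G H c d) (hk : 0 < k) :
    ∃ ψ : Equiv.Perm (Fin n), ∀ w, c (fun _ => w) = d fun _ => ψ w := by
  obtain ⟨π, hπ⟩ := exists_perm_of_card_fiber_eq m.card_eq
  have hconst : ∀ w, π (fun _ => w) = fun _ => π (fun _ => w) ⟨0, hk⟩ := fun w =>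
    funext fun i => (m.eq_iff (hπ fun _ => w) i ⟨0, hk⟩).1 rfl
  have hinj : Function.Injective fun w : Fin n => π (fun _ => w) ⟨0, hk⟩ := by
    intro w w' h
    have : π (fun _ => w) = π fun _ => w' := by
      rw [hconst w, hconst w']
      exact funext fun _ => h
    exact congrFun (π.injective this) ⟨0, hk⟩
  exact ⟨Equiv.ofBijective _ (Finite.injective_iff_bijective.1 hinj), fun w => by
    rw [hπ, hconst]
    rfl⟩

/-- List the family as a k-tuple `a ∘ g` and take its bijection. A k-tuple from the extended family
that uses the new vertex involves at most k-1 old members, so some position of the list is free to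
receive that vertex; substitution does the rest. One bijection must serve all positions, since the
free one depends on `f`. -/
theorem exists_perm_extend [Fintype ι] (m : IsMatching G H c d) (hk : 0 < k)
    (hι : Fintype.card ι ≤ k) {a b : ι → Fin n} (hab : famColour c a = famColour d b) :
    ∃ ψ : Equiv.Perm (Fin n), ∀ w, famColour c (extend w a) = famColour d (extend (ψ w) b) := by
  rcases isEmpty_or_nonempty ι with hE | hN
  · obtain ⟨ψ, hψ⟩ := m.exists_perm_const hk
    refine ⟨ψ, fun w => funext fun f => ?_⟩
    have hnone : ∀ l, f l = none := fun l => by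
      cases h : f l with
      | none => rfl
      | some x => exact (hE.false x).elim
    have hf : ∀ (w : Fin n) (a : ι → Fin n), extend w a ∘ f = fun _ => w := fun w a =>
      funext fun l => by simp [extend, hnone]
    rw [famColour, famColour, hf, hf, hψ]
  · obtain ⟨e⟩ : Nonempty (ι ↪ Fin k) := by
      rw [Function.Embedding.nonempty_iff_card_le, Fintype.card_fin]
      exact hι
    let g : Fin k → ι := Function.invFun e
    have hge : ∀ x, g (e x) = x := Function.leftInverse_invFun e.injective
    obtain ⟨ψ, hψ⟩ := m.exists_perm (congrFun hab g)
    refine ⟨ψ, fun w => funext fun f => ?_⟩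
    by_cases hf : ∃ l, f l = none
    · obtain ⟨l₀, hl₀⟩ := hf
      obtain ⟨i, hi⟩ : ∃ i, ∀ l x, f l = some x → e x ≠ i := by
        have hcard : ((Finset.univ.erase l₀).image fun l => (f l).elim l₀ e).card <
            (Finset.univ : Finset (Fin k)).card :=
          Finset.card_image_le.trans_lt (Finset.card_erase_lt_of_mem (Finset.mem_univ l₀))
        obtain ⟨i, -, hi⟩ := Finset.exists_mem_notMem_of_card_lt_card hcard
        refine ⟨i, fun l x hl hx => hi (Finset.mem_image.2 ⟨l, ?_, ?_⟩)⟩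
        · refine Finset.mem_erase.2 ⟨?_, Finset.mem_univ _⟩
          rintro rfl
          simp [hl₀] at hl
        · simp [hl, hx]
      have hfac : ∀ (w : Fin n) (a : ι → Fin n),
          extend w a ∘ f = Function.update (a ∘ g) i w ∘ fun l => (f l).elim i e := by
        intro w a
        funext l
        rw [Function.comp_apply, Function.comp_apply]
        cases h : f l with
        | none => simp [extend]
        | some x => simp [extend, Function.update_of_ne (hi l x h), hge]
      rw [famColour, famColour, hfac, hfac]
      exact m.comp (hψ i w) _
    · have hsome : ∀ l, ∃ x, f l = some x := fun l =>
        Option.ne_none_iff_exists'.1 fun h => hf ⟨l, h⟩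
      choose f' hf' using hsome
      have hfac : ∀ (w : Fin n) (a : ι → Fin n), extend w a ∘ f = a ∘ f' := fun w a =>
        funext fun l => by simp [extend, hf']
      rw [famColour, famColour, hfac, hfac]
      exact congrFun hab f'

theorem fam_eq_iff (m : IsMatching G H c d) (hk : 1 < k) {a b : ι → Fin n}
    (hab : famColour c a = famColour d b) (i j : ι) : a i = a j ↔ b i = b j := by
  have := m.eq_iff (congrFun hab fun l => if l = ⟨0, by omega⟩ then i else j) ⟨0, by omega⟩ ⟨1, hk⟩
  simpa using this

theorem fam_adj_iff (m : IsMatching G H c d) (hk : 1 < k) {a b : ι → Fin n}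
    (hab : famColour c a = famColour d b) (i j : ι) : G.Adj (a i) (a j) ↔ H.Adj (b i) (b j) := by
  have := m.adj_iff (congrFun hab fun l => if l = ⟨0, by omega⟩ then i else j) ⟨0, by omega⟩
    ⟨1, hk⟩
  simpa using this

/-- Colours determine equality patterns, so every family coloured like `b ∘ g` repeats members along
`g`; composing with `g` is a bijection of colour classes. -/
theorem weight_comp {ι' : Type*} (m : IsMatching G H c d) (hk : 1 < k) (a b : ι → Fin n)
    {g : ι' → ι} (hg : g.Surjective) : weight c d (a ∘ g) (b ∘ g) = weight c d a b := by
  by_cases hab : famColour c a = famColour d b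
  · have hab' := famColour_comp hab g
    rw [weight, weight, if_pos hab, if_pos hab', classCard, classCard]
    congr 2
    refine (Nat.card_congr (Equiv.ofBijective
      (fun b' : {b' // famColour d b' = famColour d b} =>
        (⟨b'.1 ∘ g, famColour_comp b'.2 g⟩ :
          {b' // famColour d b' = famColour d (b ∘ g)})) ⟨fun b₁ b₂ h => ?_, ?_⟩)).symm
    · exact Subtype.ext (hg.injective_comp_right (Subtype.ext_iff.1 h))
    · rintro ⟨b', hb'⟩
      obtain ⟨s, hs⟩ := hg.hasRightInverse
      have hfac : (b' ∘ s) ∘ g = b' := funext fun x =>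
        (m.fam_eq_iff hk (hab'.trans hb'.symm) _ _).1 (congrArg a (hs (g x)))
      refine ⟨⟨b' ∘ s, ?_⟩, Subtype.ext hfac⟩
      refine (famColour_of_comp hg ?_).symm.trans hab
      rw [hfac, hab', hb']
  · rw [weight, weight, if_neg hab, if_neg fun h => hab (famColour_of_comp hg h)]

theorem card_extend_eq [Fintype ι] (m : IsMatching G H c d) (hk : 0 < k)
    (hι : Fintype.card ι ≤ k) {a b : ι → Fin n} (hab : famColour c a = famColour d b)
    (s : (Fin k → Option ι) → K) :
    Nat.card {w // famColour c (extend w a) = s} = Nat.card {w // famColour d (extend w b) = s} := by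
  obtain ⟨ψ, hψ⟩ := m.exists_perm_extend hk hι hab
  exact Nat.card_congr (ψ.subtypeEquiv fun w => by rw [hψ])

/-- Fibre the larger class over its restriction to the old members: all fibres have the same size.
-/
theorem classCard_extend [Fintype ι] (m : IsMatching G H c d) (hk : 0 < k)
    (hι : Fintype.card ι ≤ k) {a b : ι → Fin n} (hab : famColour c a = famColour d b)
    (w : Fin n) :
    classCard d (famColour d (extend w b)) = classCard d (famColour d b) *
      Nat.card {w' // famColour d (extend w' b) = famColour d (extend w b)} := by
  set s := famColour d (extend w b) with hs
  have hext : ∀ b' : Option ι → Fin n, extend (b' none) (b' ∘ some) = b' := fun b' =>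
    funext fun o => by cases o <;> rfl
  let E : {b' : Option ι → Fin n // famColour d b' = s} ≃
      Σ b' : {b' : ι → Fin n // famColour d b' = famColour d b},
        {w' // famColour d (extend w' b'.1) = s} :=
    { toFun := fun b' => ⟨⟨b'.1 ∘ some, famColour_comp (b'.2.trans hs) some⟩,
        ⟨b'.1 none, by rw [hext, b'.2]⟩⟩
      invFun := fun p => ⟨extend p.2.1 p.1.1, p.2.2⟩
      left_inv := fun b' => Subtype.ext (hext b'.1)
      right_inv := fun p => rfl }
  classical
  -- Both `b'` and `b` live in H, while a matching compares G with H; the comparison passes through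
  -- `a`.
  rw [classCard, Nat.card_congr E, Nat.card_sigma, Finset.sum_congr rfl fun b' _ =>
    (m.card_extend_eq hk hι (hab.trans b'.2.symm) s).symm.trans (m.card_extend_eq hk hι hab s)]
  simp only [Finset.sum_const, Finset.card_univ, smul_eq_mul, classCard, Nat.card_eq_fintype_card]

theorem natCast_mul_inv_classCard [Fintype ι] (m : IsMatching G H c d) (hk : 0 < k)
    (hι : Fintype.card ι ≤ k) {a b : ι → Fin n} (hab : famColour c a = famColour d b)
    (w : Fin n) :
    (Nat.card {w' // famColour d (extend w' b) = famColour d (extend w b)} : ℝ) *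
      (classCard d (famColour d (extend w b)) : ℝ)⁻¹ = (classCard d (famColour d b) : ℝ)⁻¹ := by
  have : Nonempty {w' // famColour d (extend w' b) = famColour d (extend w b)} := ⟨⟨w, rfl⟩⟩
  have hpos : (Nat.card {w' // famColour d (extend w' b) = famColour d (extend w b)} : ℝ) ≠ 0 :=
    Nat.cast_ne_zero.2 Nat.card_pos.ne'
  rw [m.classCard_extend hk hι hab, Nat.cast_mul, mul_inv, mul_left_comm, mul_inv_cancel₀ hpos,
    mul_one]

theorem weight_extend_of_ne {a b : ι → Fin n} (hab : famColour c a ≠ famColour d b)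
    (w w' : Fin n) : weight c d (extend w a) (extend w' b) = 0 :=
  if_neg fun h => hab (famColour_comp h some)

theorem sum_weight_right [Fintype ι] (m : IsMatching G H c d) (hk : 0 < k)
    (hι : Fintype.card ι ≤ k) (a b : ι → Fin n) (w : Fin n) :
    ∑ w', weight c d (extend w a) (extend w' b) = weight c d a b := by
  classical
  by_cases hab : famColour c a = famColour d b
  · obtain ⟨ψ, hψ⟩ := m.exists_perm_extend hk hι hab
    have hterm : ∀ w', weight c d (extend w a) (extend w' b) =
        if famColour d (extend w' b) = famColour d (extend (ψ w) b) then
          (classCard d (famColour d (extend (ψ w) b)) : ℝ)⁻¹ else 0 := by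
      intro w'
      rw [weight, hψ]
      by_cases h : famColour d (extend (ψ w) b) = famColour d (extend w' b)
      · rw [if_pos h, if_pos h.symm, h]
      · rw [if_neg h, if_neg (Ne.symm h)]
    rw [Finset.sum_congr rfl fun w' _ => hterm w', ← Finset.sum_filter, Finset.sum_const,
      nsmul_eq_mul, ← Fintype.card_subtype, ← Nat.card_eq_fintype_card,
      m.natCast_mul_inv_classCard hk hι hab, weight, if_pos hab]
  · rw [weight, if_neg hab]
    exact Finset.sum_eq_zero fun w' _ => weight_extend_of_ne hab w w'

theorem sum_weight_left [Fintype ι] (m : IsMatching G H c d) (hk : 0 < k)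
    (hι : Fintype.card ι ≤ k) (a b : ι → Fin n) (w' : Fin n) :
    ∑ w, weight c d (extend w a) (extend w' b) = weight c d a b := by
  classical
  by_cases hab : famColour c a = famColour d b
  · have hterm : ∀ w, weight c d (extend w a) (extend w' b) =
        if famColour c (extend w a) = famColour d (extend w' b) then
          (classCard d (famColour d (extend w' b)) : ℝ)⁻¹ else 0 := by
      intro w
      rw [weight]
      congr
    rw [Finset.sum_congr rfl fun w _ => hterm w, ← Finset.sum_filter, Finset.sum_const, nsmul_eq_mul, ← Fintype.card_subtype,
      ← Nat.card_eq_fintype_card, m.card_extend_eq hk hι hab,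
      m.natCast_mul_inv_classCard hk hι hab, weight, if_pos hab]
  · rw [weight, if_neg hab]
    exact Finset.sum_eq_zero fun w _ => weight_extend_of_ne hab w w'

/-- If the pair already belongs to `I`, the extended family has a repetition, which `weight_comp`
permits. -/
theorem weight_insert (m : IsMatching G H c d) (hk : 1 < k) (I : Finset (Fin n × Fin n))
    (w w' : Fin n) :
    weight c d (fun p : ↥(insert (w, w') I) => p.1.1) (fun p => p.1.2) =
      weight c d (extend w fun p : I => p.1.1) (extend w' fun p : I => p.1.2) := by
  let g : Option I → ↥(insert (w, w') I) := fun o =>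
    o.elim ⟨(w, w'), Finset.mem_insert_self _ _⟩ fun p => ⟨p.1, Finset.mem_insert_of_mem p.2⟩
  have hg : g.Surjective := by
    rintro ⟨p, hp⟩
    rcases Finset.mem_insert.1 hp with rfl | hp'
    · exact ⟨none, rfl⟩
    · exact ⟨some ⟨p, hp'⟩, rfl⟩
  rw [← m.weight_comp hk _ _ hg]
  congr 1 <;> exact funext fun o => by cases o <;> rfl

theorem isConsistent (m : IsMatching G H c d) (hk : 1 < k) :
    IsConsistent k G H fun I => weight c d (fun p : I => p.1.1) fun p => p.1.2 where
  empty := by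
    have hE : IsEmpty (Fin k → (∅ : Finset (Fin n × Fin n))) :=
      ⟨fun f => Finset.notMem_empty _ (f ⟨0, by omega⟩).2⟩
    have hcol : ∀ s t : (Fin k → (∅ : Finset (Fin n × Fin n))) → K, s = t := fun s t =>
      funext fun f => hE.elim f
    rw [weight, if_pos (hcol _ _), classCard, inv_eq_one, Nat.cast_eq_one, Nat.card_eq_one_iff_unique]
    exact ⟨inferInstance, ⟨⟨fun p => p.1.2, rfl⟩⟩⟩
  nonneg I _ := by
    simp only [weight]
    split_ifs <;> positivity
  row_sum I hI u := by
    simp only [m.weight_insert hk]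
    exact m.sum_weight_right (by omega) (by simpa using hI) _ _ u
  col_sum I hI v := by
    simp only [m.weight_insert hk]
    exact m.sum_weight_left (by omega) (by simpa using hI) _ _ v
  eq_zero I _ u₁ u₂ v₁ v₂ hne := if_neg fun h => hne
    (m.fam_adj_iff hk h ⟨(u₁, v₁), by simp⟩ ⟨(u₂, v₂), by simp⟩)

theorem weight_singleton_pos {u v : Fin n} (h : c (fun _ => u) = d fun _ => v) :
    0 < weight c d (fun p : ({(u, v)} : Finset (Fin n × Fin n)) => p.1.1) fun p => p.1.2 := by
  have hfst : ∀ p : ({(u, v)} : Finset (Fin n × Fin n)), p.1 = (u, v) := fun p =>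
    Finset.mem_singleton.1 p.2
  rw [weight, if_pos (funext fun f => ?_)]
  · have : Nonempty {b : ({(u, v)} : Finset (Fin n × Fin n)) → Fin n //
        famColour d b = famColour d fun p => p.1.2} := ⟨⟨_, rfl⟩⟩
    rw [classCard, inv_pos, Nat.cast_pos]
    exact Nat.card_pos
  · simpa [famColour, Function.comp_def, hfst] using h

theorem relaxationQ_nonempty (m : IsMatching G H c d) (hk : 1 < k) :
    (relaxationQ (k + 1) G H).Nonempty :=
  ⟨_, mem_relaxationQ_iff.2 ⟨_, m.isConsistent hk, fun _ _ => rfl⟩⟩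

end IsMatching

end WeisfeilerLehman

/-! ### Stable partitions are matchings -/

namespace WeisfeilerLehman

open GraphIso

variable {n k : ℕ}

/-- The old entry at `i` is discarded, so at most k-1 positions of `u` are still used and a free `j`
can hold `w`. -/
theorem exists_update_comp (f : Fin k → Fin k) (i : Fin k) :
    ∃ (j : Fin k) (f' : Fin k → Fin k), ∀ (u : Tuple n k) (w : Fin n),
      Function.update (u ∘ f) i w = Function.update u j w ∘ f' := by
  have hcard : ((Finset.univ.erase i).image f).card < (Finset.univ : Finset (Fin k)).card :=
    Finset.card_image_le.trans_lt (Finset.card_erase_lt_of_mem (Finset.mem_univ i))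
  obtain ⟨j, -, hj⟩ := Finset.exists_mem_notMem_of_card_lt_card hcard
  refine ⟨j, Function.update f i j, fun u w => funext fun l => ?_⟩
  by_cases hl : l = i
  · subst hl
    simp
  · have : f l ≠ j := fun h =>
      hj (Finset.mem_image.2 ⟨l, Finset.mem_erase.2 ⟨hl, Finset.mem_univ l⟩, h⟩)
    simp [hl, this]

theorem iterateToFixed_isFixedPt {β : Type*} {f : β → β} {x : β}
    (h : ∃ r, Function.IsFixedPt f (f^[r] x)) : Function.IsFixedPt f (iterateToFixed f x) :=
  Nat.sInf_mem (s := {r | Function.IsFixedPt f (f^[r] x)}) h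

theorem iterateToFixed_eq_iterate_add {β : Type*} {f : β → β} {x : β}
    (h : ∃ r, Function.IsFixedPt f (f^[r] x)) (t : ℕ) :
    iterateToFixed f x = f^[t + sInf {r | Function.IsFixedPt f (f^[r] x)}] x := by
  rw [Function.iterate_add_apply]
  exact ((iterateToFixed_isFixedPt h).iterate t).symm

/-! #### The stable partition -/

theorem iterateToFixed_refine_isFixedPt (π : Setoid (Tuple n k)) :
    refine (iterateToFixed refine π) = iterateToFixed refine π :=
  iterateToFixed_isFixedPt (exists_fixed_refine π)

theorem stablePartition_le_iterate (G : SimpleGraph (Fin n)) (r : ℕ) :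
    stablePartition G k ≤ refine^[r] (initial G k) := by
  have hanti : Antitone fun r => refine^[r] (initial G k) := by
    refine antitone_nat_of_succ_le fun r => ?_
    rw [Function.iterate_succ_apply']
    exact fun _ _ h => h.1
  rw [stablePartition, iterateToFixed_eq_iterate_add (exists_fixed_refine _) r]
  exact hanti (Nat.le_add_right _ _)

theorem stablePartition_perm {G : SimpleGraph (Fin n)} {u v : Tuple n k}
    (h : stablePartition G k u v) : ∃ ψ : Equiv.Perm (Fin n), ∀ (i : Fin k) (w : Fin n),
      stablePartition G k (Function.update u i w) (Function.update v i (ψ w)) := by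
  have hfix := iterateToFixed_refine_isFixedPt (initial G k)
  rw [stablePartition, ← hfix] at h
  exact h.2

theorem stablePartition_comp {G : SimpleGraph (Fin n)} {u v : Tuple n k}
    (h : stablePartition G k u v) (f : Fin k → Fin k) :
    stablePartition G k (u ∘ f) (v ∘ f) := by
  -- The hypothesis stays at the stable partition, so that a bijection is available in every round.
  have hall : ∀ (r : ℕ) {u v : Tuple n k} (_ : stablePartition G k u v) (f : Fin k → Fin k),
      refine^[r] (initial G k) (u ∘ f) (v ∘ f) := by
    intro r
    induction r with
    | zero =>
      intro u v h f
      have := stablePartition_le_iterate G 0 h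
      exact ⟨fun i j => this.1 (f i) (f j), fun i j => this.2 (f i) (f j)⟩
    | succ r ih =>
      intro u v h f
      rw [Function.iterate_succ_apply']
      obtain ⟨ψ, hψ⟩ := stablePartition_perm h
      refine ⟨ih h f, ψ, fun i w => ?_⟩
      obtain ⟨j, f', hf'⟩ := exists_update_comp (n := n) f i
      rw [hf', hf']
      exact ih (hψ j w) f'
  exact hall _ h f

theorem isMatching_stablePartition (G : SimpleGraph (Fin n)) (k : ℕ) :
    IsMatching G G (Quotient.mk (stablePartition G k)) (Quotient.mk (stablePartition G k)) where
  card_eq _ := rfl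
  eq_iff h := (stablePartition_le_iterate G 0 (Quotient.exact h)).1
  adj_iff h := (stablePartition_le_iterate G 0 (Quotient.exact h)).2
  exists_perm h := (stablePartition_perm (Quotient.exact h)).imp fun _ hψ i w =>
    Quotient.sound (hψ i w)
  comp h f := Quotient.sound (stablePartition_comp (Quotient.exact h) f)

theorem relaxationQ_self_eq_iff (hk : 1 < k) (G : SimpleGraph (Fin n)) :
    relaxationQ (k + 1) G G = {1} ↔ DeterminesAsymmetric k G := by
  have m := isMatching_stablePartition G k
  constructor
  · intro h u v huv
    by_contra hne
    obtain ⟨i, hi⟩ := Function.ne_iff.1 hne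
    have hmem : Matrix.of (fun u v => weight (Quotient.mk (stablePartition G k))
        (Quotient.mk (stablePartition G k))
        (fun p : ({(u, v)} : Finset (Fin n × Fin n)) => p.1.1) fun p => p.1.2) ∈
          relaxationQ (k + 1) G G :=
      mem_relaxationQ_iff.2 ⟨_, m.isConsistent hk, fun _ _ => rfl⟩
    rw [h, Set.mem_singleton_iff] at hmem
    -- Substitution turns `u` and `v` into the constant tuples at a coordinate where they differ.
    have hpos := IsMatching.weight_singleton_pos (m.comp (Quotient.sound huv) fun _ => i)
    have hzero := congrFun (congrFun hmem (u i)) (v i)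
    rw [Matrix.one_apply_ne hi] at hzero
    exact hpos.ne' hzero
  · intro h
    obtain ⟨M, hM⟩ := m.relaxationQ_nonempty hk
    refine Set.Subset.antisymm (fun M hM => eq_one_of_determinesAsymmetric (by omega) h hM) ?_
    rw [Set.singleton_subset_iff, ← eq_one_of_determinesAsymmetric (by omega) h hM]
    exact hM

/-! #### The stable ordered partitions -/

theorem index_congr {α K L : Type*} [Fintype α] [LinearOrder K] [LinearOrder L] {f : α → K}
    {g : α → L} (h : ∀ u v, f u ≤ f v ↔ g u ≤ g v) : index f = index g := by
  have heq : ∀ u v, f u = f v ↔ g u = g v := fun u v => by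
    rw [le_antisymm_iff, le_antisymm_iff, h, h]
  funext u
  rw [index, index]
  refine Finset.card_bij (fun x hx => g (Finset.mem_image.1 (Finset.mem_filter.1 hx).1).choose)
    ?_ ?_ ?_
  · intro x hx
    have hs := (Finset.mem_image.1 (Finset.mem_filter.1 hx).1).choose_spec.2
    refine Finset.mem_filter.2 ⟨Finset.mem_image_of_mem _ (Finset.mem_univ _), (h _ _).1 ?_⟩
    rw [hs]
    exact (Finset.mem_filter.1 hx).2
  · intro x hx x' hx' hxx
    rw [← (Finset.mem_image.1 (Finset.mem_filter.1 hx).1).choose_spec.2,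
      ← (Finset.mem_image.1 (Finset.mem_filter.1 hx').1).choose_spec.2]
    exact (heq _ _).2 hxx
  · intro z hz
    obtain ⟨hz, hzu⟩ := Finset.mem_filter.1 hz
    obtain ⟨v, -, rfl⟩ := Finset.mem_image.1 hz
    have hv : f v ∈ (Finset.univ.image f).filter (· ≤ f u) :=
      Finset.mem_filter.2 ⟨Finset.mem_image_of_mem _ (Finset.mem_univ _), (h _ _).2 hzu⟩
    exact ⟨f v, hv, (heq _ _).1
      (Finset.mem_image.1 (Finset.mem_filter.1 hv).1).choose_spec.2⟩

theorem orderedRefine_orderedStablePartition (G : SimpleGraph (Fin n)) (k : ℕ) :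
    index (refineKey (orderedStablePartition G k)) = orderedStablePartition G k :=
  iterateToFixed_isFixedPt (exists_fixed_orderedRefine G k)

theorem lt_orderedRefine {c : Tuple n k → ℕ} {u v : Tuple n k} (h : c u < c v) :
    orderedRefine c u < orderedRefine c v :=
  index_lt_iff.2 (Prod.Lex.toLex_lt_toLex.2 (Or.inl h))

theorem orderedStablePartition_lt {G : SimpleGraph (Fin n)} {u v : Tuple n k}
    (h : orderedInitial G k u < orderedInitial G k v) :
    orderedStablePartition G k u < orderedStablePartition G k v := by
  rw [orderedStablePartition, iterateToFixed]
  generalize sInf {r | Function.IsFixedPt orderedRefine (orderedRefine^[r] (orderedInitial G k))} = r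
  induction r with
  | zero => exact h
  | succ r ih =>
    rw [Function.iterate_succ_apply']
    exact lt_orderedRefine ih

theorem index_typeKey (G : SimpleGraph (Fin n)) (k : ℕ) :
    index (typeKey G (orderedInitial G k)) = orderedInitial G k := by
  refine index_congr fun u v => ?_
  rw [← not_lt, ← not_lt, not_iff_not, typeKey, typeKey, Prod.Lex.toLex_lt_toLex, orderedInitial,
    index_lt_iff]
  exact ⟨fun h => h.elim id And.right, Or.inl⟩

theorem card_le_eq_of_card_fiber_eq {α : Type*} [Finite α] {f g : α → ℕ}
    (h : ∀ s, Nat.card {a // f a = s} = Nat.card {a // g a = s}) (t : ℕ) :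
    Nat.card {a // f a ≤ t} = Nat.card {a // g a ≤ t} := by
  obtain ⟨π, hπ⟩ := exists_perm_of_card_fiber_eq h
  exact Nat.card_congr (π.subtypeEquiv fun a => by rw [hπ])

/-- A coarser order-compatible colouring is determined by the sizes of initial segments. -/
theorem le_iff_card_le {α : Type*} [Finite α] {c₀ c : α → ℕ}
    (h : ∀ u v, c₀ u < c₀ v → c u < c v) (u : α) (t : ℕ) :
    c₀ u ≤ t ↔ Nat.card {a // c a ≤ c u} ≤ Nat.card {a // c₀ a ≤ t} := by
  constructor
  · intro hu
    refine Nat.card_mono (Set.toFinite {a | c₀ a ≤ t}) fun a (ha : c a ≤ c u) => ?_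
    exact le_trans (not_lt.1 fun hlt => ha.not_gt (h u a hlt)) hu
  · intro hcard
    by_contra hu
    refine hcard.not_gt (Set.ncard_lt_ncard (s := {a | c₀ a ≤ t}) (t := {a | c a ≤ c u})
      ⟨fun a (ha : c₀ a ≤ t) => (h a u (by omega)).le, fun hs => hu ?_⟩ (Set.toFinite _))
    exact hs (le_refl (c u))

section Ordered

variable {G H : SimpleGraph (Fin n)}

/-- Refinement keeps the order of cells, so initial indices can be read off the sizes of initial
segments, and these agree in G and H. -/
theorem orderedInitial_eq_of_stable
    (h₀ : KeyEquiv (typeKey G (orderedInitial G k)) (typeKey H (orderedInitial H k)))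
    (h : KeyEquiv (refineKey (orderedStablePartition G k))
      (refineKey (orderedStablePartition H k))) {u v : Tuple n k}
    (huv : orderedStablePartition G k u = orderedStablePartition H k v) :
    orderedInitial G k u = orderedInitial H k v := by
  have hs₀ := h₀.1
  have hs := h.1
  rw [index_typeKey, index_typeKey] at hs₀
  rw [orderedRefine_orderedStablePartition, orderedRefine_orderedStablePartition] at hs
  refine eq_of_forall_ge_iff fun t => ?_
  have hle : ∀ (G : SimpleGraph (Fin n)) (u : Tuple n k), orderedInitial G k u ≤ t ↔
      Nat.card {a // orderedStablePartition G k a ≤ orderedStablePartition G k u} ≤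
        Nat.card {a // orderedInitial G k a ≤ t} := fun G u =>
    le_iff_card_le (c₀ := orderedInitial G k) (c := orderedStablePartition G k)
      (fun _ _ => orderedStablePartition_lt) u t
  rw [hle, hle, huv,
    card_le_eq_of_card_fiber_eq hs, card_le_eq_of_card_fiber_eq hs₀]

theorem orderedInitial_eq_iff
    (h₀ : KeyEquiv (typeKey G (orderedInitial G k)) (typeKey H (orderedInitial H k)))
    {u v : Tuple n k} :
    orderedInitial G k u = orderedInitial H k v ↔ typeMatrix G u = typeMatrix H v := by
  obtain ⟨hs, hkey⟩ := h₀
  simp only [index_typeKey] at hs hkey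
  have hmp : ∀ {u v}, orderedInitial G k u = orderedInitial H k v →
      typeMatrix G u = typeMatrix H v := fun huv =>
    (Prod.mk.inj (toLex_inj.1 ((hkey _ _).2 huv))).2
  refine ⟨hmp, fun huv => ?_⟩
  obtain ⟨π, hπ⟩ := exists_perm_of_card_fiber_eq hs
  rw [hπ, orderedInitial, index_eq_iff, ← huv, hmp (hπ u)]

theorem orderedStablePartition_perm
    (h : KeyEquiv (refineKey (orderedStablePartition G k))
      (refineKey (orderedStablePartition H k))) {u v : Tuple n k}
    (huv : orderedStablePartition G k u = orderedStablePartition H k v) :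
    ∃ ψ : Equiv.Perm (Fin n), ∀ (i : Fin k) (w : Fin n),
      orderedStablePartition G k (Function.update u i w) =
        orderedStablePartition H k (Function.update v i (ψ w)) := by
  refine (refineKey_eq_iff.1 ((h.2 u v).2 ?_)).2
  rwa [orderedRefine_orderedStablePartition, orderedRefine_orderedStablePartition]

theorem iterate_comp_eq_of_stable
    (h₀ : KeyEquiv (typeKey G (orderedInitial G k)) (typeKey H (orderedInitial H k)))
    (h : KeyEquiv (refineKey (orderedStablePartition G k))
      (refineKey (orderedStablePartition H k))) (r : ℕ) :
    ∀ {u v : Tuple n k}, orderedStablePartition G k u = orderedStablePartition H k v →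
      ∀ f : Fin k → Fin k, orderedRefine^[r] (orderedInitial G k) (u ∘ f) =
        orderedRefine^[r] (orderedInitial H k) (v ∘ f) := by
  have hs := h.1
  rw [orderedRefine_orderedStablePartition, orderedRefine_orderedStablePartition] at hs
  obtain ⟨π, hπ⟩ := exists_perm_of_card_fiber_eq hs
  induction r with
  | zero =>
    intro u v huv f
    have := typeMatrix_eq_iff.1 ((orderedInitial_eq_iff h₀).1 (orderedInitial_eq_of_stable h₀ h huv))
    exact (orderedInitial_eq_iff h₀).2 (typeMatrix_eq_iff.2
      ⟨fun i j => this.1 (f i) (f j), fun i j => this.2 (f i) (f j)⟩)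
  | succ r ih =>
    have hkey : ∀ {u v : Tuple n k}, orderedStablePartition G k u = orderedStablePartition H k v →
        ∀ f : Fin k → Fin k, refineKey (orderedRefine^[r] (orderedInitial G k)) (u ∘ f) =
          refineKey (orderedRefine^[r] (orderedInitial H k)) (v ∘ f) := by
      intro u v huv f
      obtain ⟨ψ, hψ⟩ := orderedStablePartition_perm h huv
      refine refineKey_eq_iff.2 ⟨ih huv f, ψ, fun i w => ?_⟩
      obtain ⟨j, f', hf'⟩ := exists_update_comp (n := n) f i
      rw [hf', hf']
      exact ih (hψ j w) f'
    intro u v huv f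
    rw [Function.iterate_succ_apply', Function.iterate_succ_apply']
    -- The case `f = id` along `π` shows that both graphs attain the same keys.
    exact index_eq_of_image_eq (range_eq_of_perm π fun u => hkey (hπ u) id) (hkey huv f)

theorem isMatching_orderedStablePartition
    (h₀ : KeyEquiv (typeKey G (orderedInitial G k)) (typeKey H (orderedInitial H k)))
    (h : KeyEquiv (refineKey (orderedStablePartition G k))
      (refineKey (orderedStablePartition H k))) :
    IsMatching G H (orderedStablePartition G k) (orderedStablePartition H k) where
  card_eq := by
    have hs := h.1
    rwa [orderedRefine_orderedStablePartition, orderedRefine_orderedStablePartition] at hs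
  eq_iff huv := (typeMatrix_eq_iff.1
    ((orderedInitial_eq_iff h₀).1 (orderedInitial_eq_of_stable h₀ h huv))).1
  adj_iff huv := (typeMatrix_eq_iff.1
    ((orderedInitial_eq_iff h₀).1 (orderedInitial_eq_of_stable h₀ h huv))).2
  exists_perm huv := orderedStablePartition_perm h huv
  comp huv f := by
    -- The two stopping times may differ a priori; after their sum both runs are stable.
    have := iterate_comp_eq_of_stable h₀ h
      (sInf {r | Function.IsFixedPt orderedRefine (orderedRefine^[r] (orderedInitial H k))} +
        sInf {r | Function.IsFixedPt orderedRefine (orderedRefine^[r] (orderedInitial G k))}) huv f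
    rw [orderedStablePartition, orderedStablePartition,
      iterateToFixed_eq_iterate_add (exists_fixed_orderedRefine G k), this, add_comm,
      ← iterateToFixed_eq_iterate_add (exists_fixed_orderedRefine H k)]

end Ordered

theorem relaxationQ_eq_empty_iff (hk : 1 < k) (G H : SimpleGraph (Fin n)) :
    relaxationQ (k + 1) G H = ∅ ↔ DeterminesNotIsomorphic k G H := by
  rw [← not_iff_not, ← ne_eq, ← Set.nonempty_iff_ne_empty]
  constructor
  · rintro ⟨M, hM⟩
    obtain ⟨y, hy, -⟩ := mem_relaxationQ_iff.1 hM
    exact not_determinesNotIsomorphic_of_isConsistent hy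
  · intro h
    obtain ⟨h₀, h⟩ := not_not.1 h
    exact (isMatching_orderedStablePartition h₀ h).relaxationQ_nonempty hk

end WeisfeilerLehman

theorem theorem2 (n k : ℕ) (hk : 1 < k) (G H : SimpleGraph (Fin n)) :
    (GraphIso.relaxationQ (k + 1) G G = {1} ↔ WeisfeilerLehman.DeterminesAsymmetric k G) ∧
    (GraphIso.relaxationQ (k + 1) G H = ∅ ↔ WeisfeilerLehman.DeterminesNotIsomorphic k G H) :=
  ⟨WeisfeilerLehman.relaxationQ_self_eq_iff hk G, WeisfeilerLehman.relaxationQ_eq_empty_iff hk G H⟩
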